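/- Let $\Omega \subseteq \mathbb{C}$ be a nonempty open set and let $\mathcal{A}(\Omega)$ be the ring of complex analytic functions on $\Omega$ with pointwise addition and multiplication, endowed with the compact-open topology (uniform convergence on compact subsets of $\Omega$). A Polish ring is a ring (not assumed to have a unity) with a Polish (separable, completely metrizable) topology for which addition, negation and multiplication are continuous. Then $\mathcal{A}(\Omega)$ is an algebraically determined Polish ring; that is, $\mathcal{A}(\Omega)$ is a Polish ring, and every abstract ring isomorphism $\varphi : R \to \mathcal{A}(\Omega)$ from an arbitrary Polish ring $R$ onto $\mathcal{A}(\Omega)$ is a homeomorphism. In particular, for every such $R$ and $\varphi$, the copy of $\mathbb{C}$ in $R$ carries its usual topology: if $c_\lambda \in \mathcal{A}(\Omega)$ denotes the constant function with value $\lambda$, then the map $\mathbb{C} \to R$, $\lambda \mapsto \varphi^{-1}(c_\lambda)$, is a homeomorphism of $\mathbb{C}$ with its usual topology onto its image with the subspace topology from $R$. -/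

import Mathlib

/-- A Polish ring: a ring (not necessarily with unity) with a Polish topology for which addition,
negation and multiplication are continuous. -/
class IsPolishRing (R : Type*) [NonUnitalRing R] [TopologicalSpace R] : Prop
    extends IsTopologicalRing R, PolishSpace R

/-- A topological ring `R` is algebraically determined if every abstract ring isomorphism from
a Polish ring onto `R` is a homeomorphism (hence an isomorphism of topological rings).
The universe `v` is that of the Polish rings compared with `R`. -/
def IsAlgebraicallyDetermined.{v, u} (R : Type u) [NonUnitalRing R] [TopologicalSpace R] : Prop :=
  ∀ (S : Type v) [NonUnitalRing S] [TopologicalSpace S] [IsPolishRing S] (φ : S ≃+* R),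
    IsHomeomorph φ

/-- `analyticFunctions Ω` is the algebra of complex analytic functions on the open set `Ω`, with
pointwise operations. As a subalgebra of `C(Ω, ℂ)` it carries the compact-open topology, that is,
the topology of uniform convergence on compact subsets of `Ω`. A function on the subtype `Ω` is
analytic if it is the restriction of a function that is analytic at every point of `Ω` (the values
of that function outside `Ω` are irrelevant, as `Ω` is open). -/
def analyticFunctions (Ω : TopologicalSpace.Opens ℂ) : Subalgebra ℂ C(Ω, ℂ) where
  carrier := {f | ∃ g : ℂ → ℂ, AnalyticOnNhd ℂ g (Ω : Set ℂ) ∧ ∀ x : Ω, f x = g x}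
  mul_mem' := by
    rintro f₁ f₂ ⟨g₁, h₁, e₁⟩ ⟨g₂, h₂, e₂⟩
    exact ⟨g₁ * g₂, h₁.mul h₂, fun x => by simp [e₁, e₂]⟩
  add_mem' := by
    rintro f₁ f₂ ⟨g₁, h₁, e₁⟩ ⟨g₂, h₂, e₂⟩
    exact ⟨g₁ + g₂, h₁.add h₂, fun x => by simp [e₁, e₂]⟩
  algebraMap_mem' c := ⟨fun _ => c, analyticOnNhd_const, fun _ => rfl⟩

universe w

/-! By Pettis' theorem it suffices that `φ` and `φ.symm` are Borel. Point evaluations on a countable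
dense set separate analytic functions, so `φ` is Borel once every `s ↦ (φ s).1 z` is; `φ.symm` then
follows by Lusin–Souslin. Evaluation is recovered from algebra. Any subset of `S` that is an
injective continuous image of a Borel subset of a Polish space is Borel, so algebraic conditions
whose witnesses are unique define Borel sets. Vanishing at `z` is divisibility by `w - z`. Being
constant on the component of `z` is expressed by invertibility, through the open mapping theorem.
For a constant `l`, analyticity of `∑ l ^ (n ^ 2) (w - z) ^ n` is expressed by a sequence of Taylor
remainders: it holds if `‖l‖ < 1` and fails if `‖l‖ > 1`. The set of good `l` thus lies between the
open and the closed unit disc, and its affine preimages suffice to recover the topology of `ℂ`. -/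

open Topology Filter Set in
/-- **Pettis' theorem** on automatic continuity: a Borel measurable homomorphism from a Baire
topological group to a second countable topological group is continuous. -/
theorem AddMonoidHom.continuous_of_borelMeasurable {G H : Type*} [AddGroup G] [TopologicalSpace G]
    [IsTopologicalAddGroup G] [BaireSpace G] [MeasurableSpace G] [BorelSpace G]
    [AddGroup H] [TopologicalSpace H] [IsTopologicalAddGroup H] [SecondCountableTopology H]
    [MeasurableSpace H] [BorelSpace H] (f : G →+ H) (hf : Measurable f) : Continuous f := by
  refine continuous_of_continuousAt_zero f ?_
  rw [ContinuousAt, map_zero]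
  intro V hV
  obtain ⟨W, hW, hWV⟩ : ∃ W ∈ 𝓝 (0 : H), ∀ a ∈ W, ∀ b ∈ W, a - b ∈ V := by
    have h : Tendsto (fun p : H × H => p.1 - p.2) (𝓝 (0, 0)) (𝓝 0) :=
      Continuous.tendsto' (by fun_prop) _ _ (by simp)
    have h' := h hV
    rw [nhds_prod_eq, mem_map, mem_prod_same_iff] at h'
    obtain ⟨W, hW, hWV⟩ := h'
    exact ⟨W, hW, fun a ha b hb => hWV (mk_mem_prod ha hb)⟩
  obtain ⟨O, hOW, hO, hO0⟩ := mem_nhds_iff.1 hW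
  let A : ℕ → Set G := fun n => {x | f x - TopologicalSpace.denseSeq H n ∈ O}
  have hA : ∀ n, MeasurableSet (A n) := fun n =>
    hf ((hO.preimage (by fun_prop :
      Continuous fun y : H => y - TopologicalSpace.denseSeq H n)).measurableSet)
  have hcov : ⋃ n, A n = univ := by
    refine eq_univ_of_forall fun x => mem_iUnion.2 ?_
    have ho : IsOpen {y : H | f x - y ∈ O} := hO.preimage (by fun_prop)
    obtain ⟨n, hn⟩ := (TopologicalSpace.denseRange_denseSeq H).exists_mem_open ho
      ⟨f x, by simpa using hO0⟩
    exact ⟨n, hn⟩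
  choose U hU hAU using fun n => (hA n).residualEq_isOpen
  -- Baire category: the sets `A n` cover `G`, so they are not all meagre.
  obtain ⟨n, hn⟩ : ∃ n, (U n).Nonempty := by
    by_contra! hcon
    have h1 : (⋃ n, A n : Set G) =ᵇ (⋃ n, U n : Set G) := Filter.EventuallyEq.countable_iUnion hAU
    rw [hcov] at h1
    have h2 : (univ : Set G) =ᵇ (∅ : Set G) := by simpa [hcon] using h1
    obtain ⟨x, hx⟩ := (dense_of_mem_residual (eventuallyEq_set.1 h2)).nonempty
    simp at hx
  obtain ⟨u, hu⟩ := hn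
  have hN : {x : G | x + u ∈ U n} ∈ 𝓝 (0 : G) :=
    ((hU n).preimage (by fun_prop : Continuous fun x : G => x + u)).mem_nhds (by simpa using hu)
  refine Filter.mem_map.2 (mem_of_superset hN fun x hx => ?_)
  have e1 := eventuallyEq_set.1 (hAU n)
  have e2 : ∀ᵇ y, (-x + y ∈ A n ↔ -x + y ∈ U n) :=
    tendsto_residual_of_isOpenMap (Homeomorph.addLeft (-x)).continuous
      (Homeomorph.addLeft (-x)).isOpenMap e1
  have hopen : IsOpen (U n ∩ {y | -x + y ∈ U n}) :=
    (hU n).inter ((hU n).preimage (by fun_prop))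
  -- Both `y` and `-x + y` lie in `A n`, and the difference of their images is `f x`.
  obtain ⟨y, ⟨hy1, hy2⟩, hy3, hy4⟩ := (dense_of_mem_residual (e1.and e2)).inter_open_nonempty _ hopen
    ⟨x + u, hx, by simpa using hu⟩
  have h1 : f y - TopologicalSpace.denseSeq H n ∈ O := hy3.2 hy1
  have h2 : f (-x + y) - TopologicalSpace.denseSeq H n ∈ O := hy4.2 hy2
  have := hWV _ (hOW h1) _ (hOW h2)
  simpa using this

namespace analyticFunctions

open Topology Filter Set

variable {Ω : TopologicalSpace.Opens ℂ}

/-! ### Analytic functions as a Polish ring. -/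

instance : SigmaCompactSpace Ω := by
  have : LocallyCompactSpace Ω := Ω.isOpen.locallyCompactSpace
  exact sigmaCompactSpace_of_locallyCompact_secondCountable

theorem isClosed_coe (Ω : TopologicalSpace.Opens ℂ) :
    IsClosed (analyticFunctions Ω : Set C(Ω, ℂ)) := by
  have : LocallyCompactSpace Ω := Ω.isOpen.locallyCompactSpace
  have : FrechetUrysohnSpace C(Ω, ℂ) := inferInstance
  refine isClosed_of_closure_subset fun f hf => ?_
  obtain ⟨F, hF, hlim⟩ := mem_closure_iff_seq_limit.1 hf
  choose G hG hFG using hF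
  have hl := ContinuousMap.tendsto_iff_tendstoLocallyUniformly.1 hlim
  classical
  let g : ℂ → ℂ := fun w => if h : w ∈ Ω then f ⟨w, h⟩ else 0
  have hg : ∀ x : Ω, f x = g x := fun x => by simp [g]
  refine ⟨g, ?_, hg⟩
  have hlu : TendstoLocallyUniformlyOn G g atTop (Ω : Set ℂ) := by
    rw [tendstoLocallyUniformlyOn_iff_tendstoLocallyUniformly_comp_coe]
    refine (hl.congr fun n x => hFG n x).congr_right fun x => hg x
  rw [Complex.analyticOnNhd_iff_differentiableOn Ω.isOpen]
  exact hlu.differentiableOn (Eventually.of_forall fun n => (hG n).differentiableOn) Ω.isOpen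

instance : PolishSpace (analyticFunctions Ω) := by
  have : LocallyCompactSpace Ω := Ω.isOpen.locallyCompactSpace
  have : PolishSpace C(Ω, ℂ) := inferInstance
  exact (isClosed_coe Ω).polishSpace

instance : IsPolishRing (analyticFunctions Ω) :=
  have : LocallyCompactSpace Ω := Ω.isOpen.locallyCompactSpace
  { continuous_add := continuous_add
    continuous_mul := continuous_mul
    continuous_neg := (continuous_const_mul (-1 : analyticFunctions Ω)).congr fun f => by
      ring }

/-! ### Divisibility by `w - z`. -/

theorem ext_iff_apply {f g : analyticFunctions Ω} : f = g ↔ ∀ x, f.1 x = g.1 x :=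
  ⟨fun h x => by rw [h], fun h => Subtype.ext (ContinuousMap.ext h)⟩

/-- The restriction to `Ω` of a function that is analytic on `Ω`. -/
def restrict (g : ℂ → ℂ) (hg : AnalyticOnNhd ℂ g Ω) : analyticFunctions Ω :=
  ⟨⟨fun x => g x, hg.continuousOn.domRestrict⟩, g, hg, fun _ => rfl⟩

@[simp] theorem restrict_apply (g : ℂ → ℂ) (hg : AnalyticOnNhd ℂ g Ω) (x : Ω) :
    (restrict g hg).1 x = g x := rfl

/-- The function `w ↦ w - z`. -/
def subPoint (z : Ω) : analyticFunctions Ω :=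
  restrict (fun w => w - z) (analyticOnNhd_id.sub analyticOnNhd_const)

@[simp] theorem subPoint_apply (z x : Ω) : (subPoint z).1 x = x - z := rfl

theorem mem_nhds_coe (z : Ω) : (Ω : Set ℂ) ∈ 𝓝 (z : ℂ) := Ω.isOpen.mem_nhds z.2

theorem exists_eq_subPoint_mul {z : Ω} {f : analyticFunctions Ω} (hf : f.1 z = 0) :
    ∃ g, f = subPoint z * g := by
  obtain ⟨F, hF, hfF⟩ := f.2
  refine ⟨restrict (dslope F z) ?_, ?_⟩
  · rw [Complex.analyticOnNhd_iff_differentiableOn Ω.isOpen,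
      Complex.differentiableOn_dslope (mem_nhds_coe z)]
    exact hF.differentiableOn
  · refine ext_iff_apply.2 fun x => ?_
    have h := sub_smul_dslope F z x
    rw [← hfF, ← hfF, hf, sub_zero] at h
    simpa using h.symm

/-- A function is determined off `z`. -/
theorem eq_of_forall_ne {z : Ω} {f g : analyticFunctions Ω} (h : ∀ x, x ≠ z → f.1 x = g.1 x) :
    f = g := by
  obtain ⟨F, hF, hfF⟩ := f.2
  obtain ⟨G, hG, hgG⟩ := g.2
  refine ext_iff_apply.2 fun x => ?_
  by_cases hx : x = z
  · subst hx
    have h1 : Tendsto F (𝓝[≠] (x : ℂ)) (𝓝 (F x)) :=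
      ((hF x x.2).continuousAt.tendsto).mono_left nhdsWithin_le_nhds
    have h2 : Tendsto G (𝓝[≠] (x : ℂ)) (𝓝 (G x)) :=
      ((hG x x.2).continuousAt.tendsto).mono_left nhdsWithin_le_nhds
    rw [hfF, hgG]
    refine tendsto_nhds_unique_of_eventuallyEq h1 h2 ?_
    filter_upwards [self_mem_nhdsWithin, mem_nhdsWithin_of_mem_nhds (mem_nhds_coe x)] with w hw hwΩ
    have := h ⟨w, hwΩ⟩ fun h' => hw (congrArg Subtype.val h')
    rwa [hfF, hgG] at this
  · exact h x hx

theorem subPoint_mul_injective (z : Ω) : Function.Injective fun g => subPoint z * g := by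
  intro f g hfg
  refine eq_of_forall_ne (z := z) fun x hx => ?_
  have h := ext_iff_apply.1 hfg x
  have hx' : (x : ℂ) - z ≠ 0 := sub_ne_zero.2 fun h => hx (Subtype.ext h)
  exact mul_left_cancel₀ hx' (by simpa using h)

/-! ### Component idempotents and constants. -/

theorem analyticOnNhd_indicator_connectedComponentIn (z : ℂ) :
    AnalyticOnNhd ℂ ((connectedComponentIn (Ω : Set ℂ) z).indicator 1 : ℂ → ℂ) Ω := by
  intro x hx
  by_cases h : x ∈ connectedComponentIn (Ω : Set ℂ) z
  · refine (analyticAt_const (v := (1 : ℂ))).congr ?_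
    filter_upwards [Ω.isOpen.connectedComponentIn.mem_nhds h] with w hw
    simp [hw]
  · refine (analyticAt_const (v := (0 : ℂ))).congr ?_
    filter_upwards [Ω.isOpen.connectedComponentIn.mem_nhds (mem_connectedComponentIn hx)]
      with w hw
    have : w ∉ connectedComponentIn (Ω : Set ℂ) z := fun hw' => h <| by
      rw [connectedComponentIn_eq hw', ← connectedComponentIn_eq hw]
      exact mem_connectedComponentIn hx
    simp [this]

/-- The idempotent of the connected component of `z`. -/
noncomputable def componentOne (z : Ω) : analyticFunctions Ω :=
  restrict _ (analyticOnNhd_indicator_connectedComponentIn z)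

theorem componentOne_apply_mem {z x : Ω} (hx : (x : ℂ) ∈ connectedComponentIn (Ω : Set ℂ) z) :
    (componentOne z).1 x = 1 := by
  simp [componentOne, hx]

theorem componentOne_apply_notMem {z x : Ω}
    (hx : (x : ℂ) ∉ connectedComponentIn (Ω : Set ℂ) z) : (componentOne z).1 x = 0 := by
  simp [componentOne, hx]

@[simp] theorem componentOne_apply_self (z : Ω) : (componentOne z).1 z = 1 :=
  componentOne_apply_mem (mem_connectedComponentIn z.2)

@[simp] theorem componentOne_mul_self (z : Ω) :
    componentOne z * componentOne z = componentOne z := by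
  refine ext_iff_apply.2 fun x => ?_
  by_cases hx : (x : ℂ) ∈ connectedComponentIn (Ω : Set ℂ) z
  · simp [componentOne_apply_mem hx]
  · simp [componentOne_apply_notMem hx]

theorem smul_componentOne_pow_mul (z : Ω) (l : ℂ) (k : ℕ) :
    (l • componentOne z) ^ k * componentOne z = l ^ k • componentOne z := by
  induction k with
  | zero => simp
  | succ k ih => rw [pow_succ', mul_assoc, ih, smul_mul_smul_comm, componentOne_mul_self, pow_succ']

theorem eq_of_componentOne_mul {z : Ω} {f g : analyticFunctions Ω} (hf : componentOne z * f = f)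
    (hg : componentOne z * g = g)
    (h : ∀ x : Ω, (x : ℂ) ∈ connectedComponentIn (Ω : Set ℂ) z → f.1 x = g.1 x) : f = g := by
  refine ext_iff_apply.2 fun x => ?_
  by_cases hx : (x : ℂ) ∈ connectedComponentIn (Ω : Set ℂ) z
  · exact h x hx
  · rw [← hf, ← hg]
    simp [componentOne_apply_notMem hx]

/-- The open mapping theorem: a function supported in the component of `z` that takes on that
component none of a dense set of values, or is one of these values, is constant there. -/
theorem exists_eq_smul_componentOne {z : Ω} {f : analyticFunctions Ω}
    (hf : componentOne z * f = f) {q : ℕ → ℂ} (hq : DenseRange q)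
    (h : ∀ n, f = q n • componentOne z ∨ ∃ g, (f - q n • componentOne z) * g = componentOne z) :
    ∃ l : ℂ, f = l • componentOne z := by
  obtain ⟨F, hF, hfF⟩ := f.2
  have hsub : connectedComponentIn (Ω : Set ℂ) z ⊆ Ω := connectedComponentIn_subset _ _
  obtain ⟨l, hl⟩ | ho := (hF.mono hsub).is_constant_or_isOpen isPreconnected_connectedComponentIn
  · refine ⟨l, eq_of_componentOne_mul hf (by simp) fun x hx => ?_⟩
    rw [hfF, hl x hx]
    simp [componentOne_apply_mem hx]
  · obtain ⟨n, w, hw, hwn⟩ := hq.exists_mem_open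
      (ho _ Subset.rfl Ω.isOpen.connectedComponentIn) ⟨_, mem_image_of_mem _
        (mem_connectedComponentIn z.2)⟩
    rcases h n with h | ⟨g, hg⟩
    · exact ⟨_, h⟩
    · have := ext_iff_apply.1 hg ⟨w, hsub hw⟩
      have h1 : (componentOne z).1 ⟨w, hsub hw⟩ = 1 := componentOne_apply_mem hw
      simp [h1, hfF, hwn] at this

/-! ### Taylor sequences and the unit disc. -/

/-- The functions `F n` are the successive remainders of the Taylor expansion at `z`, on the
component of `z`, of a function with Taylor coefficients `l ^ (n ^ 2)`. -/
def IsTaylorSequence (z : Ω) (l : ℂ) (F : ℕ → analyticFunctions Ω) : Prop :=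
  ∀ n, componentOne z * F n = F n ∧ F n = l ^ n ^ 2 • componentOne z + subPoint z * F (n + 1)

theorem IsTaylorSequence.apply_self {z : Ω} {l : ℂ} {F : ℕ → analyticFunctions Ω}
    (h : IsTaylorSequence z l F) (n : ℕ) : (F n).1 z = l ^ n ^ 2 := by
  have := ext_iff_apply.1 (h n).2 z
  simpa using this

theorem exists_closedBall_subset (z : Ω) :
    ∃ r > 0, Metric.closedBall (z : ℂ) r ⊆ connectedComponentIn (Ω : Set ℂ) z :=
  Metric.nhds_basis_closedBall.mem_iff.1
    (Ω.isOpen.connectedComponentIn.mem_nhds (mem_connectedComponentIn z.2))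

/-- The maximum principle on a disc contained in the component of `z`. -/
theorem norm_apply_center_le {z : Ω} {r : ℝ} (hr : 0 < r)
    (hrs : Metric.closedBall (z : ℂ) r ⊆ connectedComponentIn (Ω : Set ℂ) z)
    (f : analyticFunctions Ω) {C : ℝ}
    (hC : ∀ x : Ω, (x : ℂ) ∈ Metric.sphere (z : ℂ) r → ‖f.1 x‖ ≤ C) : ‖f.1 z‖ ≤ C := by
  obtain ⟨F, hF, hfF⟩ := f.2
  have hsub := hrs.trans (connectedComponentIn_subset (Ω : Set ℂ) z)
  rw [hfF]
  refine Complex.norm_le_of_forall_mem_frontier_norm_le (U := Metric.ball (z : ℂ) r)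
    Metric.isBounded_ball ((hF.differentiableOn.mono hsub).diffContOnCl_ball subset_rfl) ?_
    (subset_closure (Metric.mem_ball_self hr))
  intro w hw
  rw [frontier_ball _ hr.ne'] at hw
  have := hC ⟨w, hsub (Metric.sphere_subset_closedBall hw)⟩ hw
  rwa [hfF] at this

theorem exists_norm_le_on_sphere {z : Ω} {r : ℝ}
    (hrs : Metric.closedBall (z : ℂ) r ⊆ connectedComponentIn (Ω : Set ℂ) z)
    (f : analyticFunctions Ω) :
    ∃ C, ∀ x : Ω, (x : ℂ) ∈ Metric.sphere (z : ℂ) r → ‖f.1 x‖ ≤ C := by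
  obtain ⟨F, hF, hfF⟩ := f.2
  have hsub := hrs.trans (connectedComponentIn_subset (Ω : Set ℂ) z)
  obtain ⟨C, hC⟩ := (isCompact_sphere (z : ℂ) r).exists_bound_of_continuousOn
    (hF.continuousOn.mono (Metric.sphere_subset_closedBall.trans hsub))
  exact ⟨C, fun x hx => by rw [hfF]; exact hC x hx⟩

/-- Each remainder is a difference quotient of the previous one, so its bound on a small circle
grows by a factor of at most `2 / r`. Geometric growth cannot dominate `‖l‖ ^ (n ^ 2)` when `‖l‖ >
1`. -/
theorem IsTaylorSequence.norm_le_one {z : Ω} {l : ℂ} {F : ℕ → analyticFunctions Ω}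
    (h : IsTaylorSequence z l F) : ‖l‖ ≤ 1 := by
  obtain ⟨r, hr, hrs⟩ := exists_closedBall_subset z
  obtain ⟨C, hC⟩ := exists_norm_le_on_sphere hrs (F 0)
  have key : ∀ n, ∀ x : Ω, (x : ℂ) ∈ Metric.sphere (z : ℂ) r → ‖(F n).1 x‖ ≤ C * (2 / r) ^ n := by
    intro n
    induction n with
    | zero => simpa using hC
    | succ n ih =>
      intro x hx
      have h1 := norm_apply_center_le hr hrs (F n) ih
      have h2 := ih x hx
      have h3 := ext_iff_apply.1 (h n).2 x
      have hxc := hrs (Metric.sphere_subset_closedBall hx)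
      have h4 : (F n).1 x - (F n).1 z = (x - z) * (F (n + 1)).1 x := by
        rw [h.apply_self, h3]
        simp [componentOne_apply_mem hxc]
      have h5 : ‖(x : ℂ) - z‖ = r := by simpa [dist_eq_norm] using hx
      have h6 : r * ‖(F (n + 1)).1 x‖ ≤ C * (2 / r) ^ n + C * (2 / r) ^ n := by
        calc r * ‖(F (n + 1)).1 x‖ = ‖(F n).1 x - (F n).1 z‖ := by rw [h4, norm_mul, h5]
          _ ≤ _ := (norm_sub_le _ _).trans (add_le_add h2 h1)
      rw [pow_succ, ← mul_assoc, mul_div_assoc', le_div_iff₀ hr]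
      linarith
  by_contra! hl
  have hb : ∀ n, (‖l‖ ^ n * (r / 2)) ^ n ≤ C := fun n => by
    have h1 := norm_apply_center_le hr hrs (F n) (key n)
    rw [h.apply_self, norm_pow, sq, pow_mul] at h1
    have h2 := mul_le_mul_of_nonneg_right h1 (by positivity : 0 ≤ (r / 2) ^ n)
    rw [mul_assoc, ← mul_pow, ← mul_pow] at h2
    simpa [show 2 / r * (r / 2) = 1 by field_simp] using h2
  have ht : Tendsto (fun n => ‖l‖ ^ n * (r / 2)) atTop atTop :=
    (tendsto_pow_atTop_atTop_of_one_lt hl).atTop_mul_const (by positivity)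
  obtain ⟨n, hn1, hn2, hn0⟩ := ((ht.eventually_ge_atTop 1).and
    ((ht.eventually_gt_atTop C).and (eventually_ne_atTop 0))).exists
  exact absurd (hb n) (not_le.2 (hn2.trans_le (le_self_pow₀ hn1 hn0)))

/-- Divisibility by every power of `w - z` forces infinite order at `z`; the identity theorem
finishes on the component. This gives uniqueness of Taylor sequences. -/
theorem eq_zero_of_eq_subPoint_mul_succ {z : Ω} {H : ℕ → analyticFunctions Ω}
    (he : ∀ n, componentOne z * H n = H n) (hH : ∀ n, H n = subPoint z * H (n + 1)) (n : ℕ) :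
    H n = 0 := by
  refine eq_of_componentOne_mul (he n) (by simp) fun x hx => ?_
  obtain ⟨F, hF, hfF⟩ := (H n).2
  have hsub : connectedComponentIn (Ω : Set ℂ) z ⊆ Ω := connectedComponentIn_subset _ _
  have hpow : ∀ k, H n = subPoint z ^ k * H (n + k) := by
    intro k
    induction k with
    | zero => simp
    | succ k ih => rw [ih, hH (n + k), pow_succ, mul_assoc]; rfl
  have hord : analyticOrderAt F z = ⊤ := by
    refine ENat.eq_top_iff_forall_ge.2 fun k => ?_
    rw [natCast_le_analyticOrderAt (hF z z.2)]
    obtain ⟨G, hG, hgG⟩ := (H (n + k)).2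
    refine ⟨G, hG z z.2, ?_⟩
    filter_upwards [mem_nhds_coe z] with w hw
    have := ext_iff_apply.1 (hpow k) ⟨w, hw⟩
    rw [hfF] at this
    simpa [hgG] using this
  have := (hF.mono hsub).eqOn_zero_of_preconnected_of_eventuallyEq_zero
    isPreconnected_connectedComponentIn (mem_connectedComponentIn z.2)
    (analyticOrderAt_eq_top.1 hord) hx
  rw [hfF, this]
  rfl

theorem IsTaylorSequence.unique {z : Ω} {l : ℂ} {F G : ℕ → analyticFunctions Ω}
    (hF : IsTaylorSequence z l F) (hG : IsTaylorSequence z l G) : F = G := by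
  funext n
  refine sub_eq_zero.1 (eq_zero_of_eq_subPoint_mul_succ (z := z) (H := fun n => F n - G n)
    (fun n => ?_) (fun n => ?_) n)
  · linear_combination (hF n).1 - (hG n).1
  · linear_combination (hF n).2 - (hG n).2

theorem summable_pow_sq_mul_pow {a : ℝ} (ha : 0 ≤ a) (ha1 : a < 1) (R : ℝ) (hR : 0 ≤ R) (n : ℕ) :
    Summable fun k : ℕ => a ^ (n + k) ^ 2 * R ^ k := by
  have ht : Tendsto (fun k : ℕ => a ^ k * R) atTop (𝓝 0) := by
    simpa using (tendsto_pow_atTop_nhds_zero_of_lt_one ha ha1).mul_const R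
  refine Summable.of_norm_bounded_eventually_nat summable_geometric_two ?_
  filter_upwards [ht.eventually_le_const (by norm_num : (0 : ℝ) < 1 / 2)] with k hk
  rw [Real.norm_of_nonneg (by positivity)]
  have hkk : k * k ≤ (n + k) ^ 2 := by
    rw [sq]
    exact Nat.mul_le_mul (Nat.le_add_left _ _) (Nat.le_add_left _ _)
  calc a ^ (n + k) ^ 2 * R ^ k ≤ a ^ (k * k) * R ^ k :=
        mul_le_mul_of_nonneg_right (pow_le_pow_of_le_one ha ha1.le hkk) (by positivity)
    _ = (a ^ k * R) ^ k := by rw [pow_mul, mul_pow]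
    _ ≤ (1 / 2) ^ k := by gcongr

/-- The shifted series are entire, because `‖l‖ ^ (k ^ 2)` beats every geometric growth. -/
theorem exists_isTaylorSequence (z : Ω) {l : ℂ} (hl : ‖l‖ < 1) :
    ∃ F, IsTaylorSequence z l F := by
  let S : ℕ → ℂ → ℂ := fun n w => ∑' k : ℕ, l ^ (n + k) ^ 2 * (w - z) ^ k
  have hsum : ∀ n w, Summable fun k : ℕ => l ^ (n + k) ^ 2 * (w - z) ^ k := fun n w =>
    Summable.of_norm (by
      simpa using summable_pow_sq_mul_pow (norm_nonneg l) hl ‖w - z‖ (norm_nonneg _) n)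
  have hS : ∀ n, Differentiable ℂ (S n) := by
    intro n w
    have := Complex.differentiableOn_tsum_of_summable_norm (U := Metric.ball (z : ℂ) (‖w - z‖ + 1))
      (F := fun k w => l ^ (n + k) ^ 2 * (w - z) ^ k)
      (summable_pow_sq_mul_pow (norm_nonneg l) hl (‖w - z‖ + 1) (by positivity) n)
      (fun k => by fun_prop) Metric.isOpen_ball (fun k v hv => by
        rw [norm_mul, norm_pow, norm_pow]
        gcongr
        exact (mem_ball_iff_norm.1 hv).le)
    exact this.differentiableAt (Metric.isOpen_ball.mem_nhds (by simp [dist_eq_norm]))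
  refine ⟨fun n => componentOne z * restrict (S n) 
    ((hS n).differentiableOn.analyticOnNhd Ω.isOpen), fun n =>
    ⟨by rw [← mul_assoc, componentOne_mul_self], ext_iff_apply.2 fun x => ?_⟩⟩
  have h : S n x = l ^ n ^ 2 + (x - z) * S (n + 1) x := by
    simp only [S]
    rw [(hsum n x).tsum_eq_zero_add, ← tsum_mul_left]
    congr 1
    · simp
    · refine tsum_congr fun k => ?_
      rw [show n + (k + 1) = n + 1 + k by ring, pow_succ]
      ring
  simp only [MulMemClass.coe_mul, ContinuousMap.mul_apply, restrict_apply, h]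
  simp
  ring

/-! ### Borel sets of `S` defined algebraically. -/

section Measurability

variable {S : Type*} [NonUnitalRing S] [TopologicalSpace S] [IsPolishRing S]
  (φ : S ≃+* analyticFunctions Ω)

/-- The factor `f` gives meaning to the power `k = 0`, as `S` has no declared unit. -/
theorem continuous_symm_pow_mul (f : analyticFunctions Ω) (k : ℕ) :
    Continuous fun s : S => φ.symm (φ s ^ k * f) := by
  induction k with
  | zero => simpa using continuous_const
  | succ k ih =>
    have h : ∀ s : S, φ.symm (φ s ^ (k + 1) * f) = s * φ.symm (φ s ^ k * f) := fun s => by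
      rw [pow_succ', mul_assoc, map_mul, φ.symm_apply_apply]
    simp only [h]
    exact continuous_id.mul ih

variable [MeasurableSpace S] [BorelSpace S]

theorem measurableSet_apply_eq_zero (z : Ω) : MeasurableSet {s : S | (φ s).1 z = 0} := by
  have hc : Continuous fun s : S => φ.symm (subPoint z) * s := by fun_prop
  have hi : Function.Injective fun s : S => φ.symm (subPoint z) * s := fun s t hst =>
    φ.injective (subPoint_mul_injective z (by simpa using congrArg φ hst))
  convert MeasureTheory.measurableSet_range_of_continuous_injective hc hi using 1
  ext s
  constructor
  · intro hs
    obtain ⟨g, hg⟩ := exists_eq_subPoint_mul hs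
    exact ⟨φ.symm g, φ.injective (by simp [hg])⟩
  · rintro ⟨t, rfl⟩
    simp

theorem measurableSet_exists_mul_eq (z : Ω) (l : ℂ) :
    MeasurableSet {s : S | ∃ g, (φ s - l • componentOne z) * g = componentOne z} := by
  -- The second equation confines the inverse to the component, which makes it unique.
  have hcl : IsClosed {p : S × S | (p.1 - φ.symm (l • componentOne z)) * p.2 =
      φ.symm (componentOne z) ∧ φ.symm (componentOne z) * p.2 = p.2} :=
    (isClosed_eq (by fun_prop) (by fun_prop)).inter (isClosed_eq (by fun_prop) (by fun_prop))
  have hi : InjOn Prod.fst {p : S × S | (p.1 - φ.symm (l • componentOne z)) * p.2 =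
      φ.symm (componentOne z) ∧ φ.symm (componentOne z) * p.2 = p.2} := by
    rintro ⟨s, g⟩ ⟨hg, hg'⟩ ⟨t, g'⟩ ⟨ht, ht'⟩ rfl
    have h1 := congrArg φ hg
    have h2 := congrArg φ hg'
    have h3 := congrArg φ ht
    have h4 := congrArg φ ht'
    simp only [map_mul, map_sub, RingEquiv.apply_symm_apply] at h1 h2 h3 h4
    refine Prod.ext rfl (φ.injective ?_)
    linear_combination -h2 + h4 - φ g * h3 + φ g' * h1
  convert hcl.measurableSet.image_of_continuousOn_injOn continuous_fst.continuousOn hi using 1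
  ext s
  constructor
  · rintro ⟨g, hg⟩
    refine ⟨(s, φ.symm (componentOne z * g)), ⟨φ.injective ?_, φ.injective ?_⟩, rfl⟩
    · have := componentOne_mul_self z
      simp only [map_mul, map_sub, RingEquiv.apply_symm_apply]
      linear_combination componentOne z * hg + this
    · simp only [map_mul, RingEquiv.apply_symm_apply]
      rw [← mul_assoc, componentOne_mul_self]
  · rintro ⟨⟨s, g⟩, ⟨hg, -⟩, rfl⟩
    exact ⟨φ g, by simpa using congrArg φ hg⟩

theorem measurableSet_eq_smul_componentOne (z : Ω) :
    MeasurableSet {s : S | ∃ l : ℂ, φ s = l • componentOne z} := by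
  let q := TopologicalSpace.denseSeq ℂ
  have h1 : MeasurableSet {s : S | φ.symm (componentOne z) * s = s} :=
    (isClosed_eq (by fun_prop) (by fun_prop)).measurableSet
  have h2 : ∀ n, MeasurableSet ({s : S | s = φ.symm (q n • componentOne z)} ∪
      {s : S | ∃ g, (φ s - q n • componentOne z) * g = componentOne z}) := fun n =>
    (isClosed_eq continuous_id continuous_const).measurableSet.union
      (measurableSet_exists_mul_eq φ z (q n))
  convert h1.inter (MeasurableSet.iInter h2) using 1
  ext s
  simp only [mem_ofPred_eq, mem_inter_iff, mem_iInter, mem_union]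
  constructor
  · rintro ⟨l, hl⟩
    refine ⟨φ.injective (by simp [hl]), fun n => ?_⟩
    by_cases h : l = q n
    · exact Or.inl (φ.injective (by simp [hl, h]))
    · refine Or.inr ⟨(l - q n)⁻¹ • componentOne z, ?_⟩
      have hs : l • componentOne z - q n • componentOne z = (l - q n) • componentOne z :=
        ext_iff_apply.2 fun x => by simp [sub_mul]
      rw [hl, hs, smul_mul_smul_comm, mul_inv_cancel₀ (sub_ne_zero.2 h),
        componentOne_mul_self, one_smul]
  · rintro ⟨h1, h2⟩
    refine exists_eq_smul_componentOne (by simpa using congrArg φ h1)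
      (TopologicalSpace.denseRange_denseSeq ℂ) fun n => ?_
    rcases h2 n with h | h
    · exact Or.inl (by simpa using congrArg φ h)
    · exact Or.inr h

theorem measurableSet_exists_isTaylorSequence (z : Ω) :
    MeasurableSet {s : S | ∃ l : ℂ, φ s = l • componentOne z ∧ ∃ F, IsTaylorSequence z l F} := by
  -- Writing the coefficient as a power of `φ p.1` eliminates `l`, so the condition is closed in the
  -- pair.
  let T : Set (S × (ℕ → S)) := {p | ∀ n, φ.symm (componentOne z) * p.2 n = p.2 n ∧
    p.2 n = φ.symm (φ p.1 ^ n ^ 2 * componentOne z) + φ.symm (subPoint z) * p.2 (n + 1)}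
  have hT : IsClosed T := by
    simp only [T, ofPred_forall]
    refine isClosed_iInter fun n => (isClosed_eq (by fun_prop) (by fun_prop)).inter
      (isClosed_eq (by fun_prop) ?_)
    have := (continuous_symm_pow_mul φ (componentOne z) (n ^ 2)).comp
      (continuous_fst (X := S) (Y := ℕ → S))
    exact this.add (by fun_prop)
  have hiff : ∀ (s : S) (G : ℕ → S) (l : ℂ), φ s = l • componentOne z →
      ((s, G) ∈ T ↔ IsTaylorSequence z l fun n => φ (G n)) := fun s G l hl =>
    forall_congr' fun n => by
      rw [← φ.injective.eq_iff, ← φ.injective.eq_iff]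
      simp [hl, smul_componentOne_pow_mul]
  have hm := (hT.measurableSet.inter (measurable_fst
    (measurableSet_eq_smul_componentOne φ z))).image_of_continuousOn_injOn
    (f := Prod.fst) continuous_fst.continuousOn (by
      rintro ⟨s, F⟩ ⟨hF, l, hl⟩ ⟨t, G⟩ ⟨hG, -⟩ rfl
      refine Prod.ext rfl (funext fun n => φ.injective ?_)
      exact congrFun (((hiff s F l hl).1 hF).unique ((hiff s G l hl).1 hG)) n)
  convert hm using 1
  ext s
  constructor
  · rintro ⟨l, hl, F, hF⟩
    exact ⟨(s, fun n => φ.symm (F n)), ⟨(hiff _ _ l hl).2 (by simpa using hF), l, hl⟩, rfl⟩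
  · rintro ⟨⟨s, G⟩, ⟨hG, l, hl⟩, rfl⟩
    exact ⟨l, hl, _, (hiff _ _ l hl).1 hG⟩

/-- Every element splits uniquely as a constant on the component of `z` plus an element vanishing at
`z`; addition is injective on such pairs. -/
theorem measurableSet_exists_isTaylorSequence_apply (z : Ω) :
    MeasurableSet {s : S | ∃ F, IsTaylorSequence z ((φ s).1 z) F} := by
  have hm := ((measurableSet_exists_isTaylorSequence φ z).prod
    (measurableSet_apply_eq_zero φ z)).image_of_continuousOn_injOn
    (f := fun p : S × S => p.1 + p.2) (by fun_prop) (by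
      rintro ⟨s, t⟩ ⟨⟨l, hl, -⟩, ht⟩ ⟨s', t'⟩ ⟨⟨l', hl', -⟩, ht'⟩ h
      have ht : (φ t).1 z = 0 := ht
      have ht' : (φ t').1 z = 0 := ht'
      have hl : φ s = l • componentOne z := hl
      have hl' : φ s' = l' • componentOne z := hl'
      have h : s + t = s' + t' := h
      have h1 := ext_iff_apply.1 (congrArg φ h) z
      have h2 : l = l' := by simpa [hl, hl', ht, ht'] using h1
      have h3 : s = s' := φ.injective (by rw [hl, hl', h2])
      subst h3
      exact Prod.ext rfl (add_left_cancel h))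
  convert hm using 1
  ext s
  constructor
  · intro hs
    refine ⟨(φ.symm ((φ s).1 z • componentOne z), s - φ.symm ((φ s).1 z • componentOne z)),
      ⟨⟨(φ s).1 z, by simp, hs⟩, ?_⟩, by simp⟩
    simp
  · rintro ⟨⟨s, t⟩, ⟨⟨l, hl, hF⟩, ht⟩, rfl⟩
    have ht : (φ t).1 z = 0 := ht
    have hl : φ s = l • componentOne z := hl
    simpa [hl, ht] using hF

theorem measurable_apply (z : Ω) : Measurable fun s : S => (φ s).1 z := by
  let q := TopologicalSpace.denseSeq ℂ
  let D : Set ℂ := {l | ∃ F, IsTaylorSequence z l F}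
  have hm : ∀ (a b : ℂ), MeasurableSet {s : S | a * ((φ s).1 z - b) ∈ D} := fun a b => by
    have hc : Continuous fun s : S =>
        φ.symm (algebraMap ℂ _ a) * (s - φ.symm (algebraMap ℂ _ b)) := by fun_prop
    convert hc.measurable (measurableSet_exists_isTaylorSequence_apply φ z) using 1
    ext s
    simp [D]
  refine measurable_of_isOpen fun U hU => ?_
  have : (fun s : S => (φ s).1 z) ⁻¹' U = ⋃ p ∈ {p : ℕ × ℕ | ∀ w : ℂ,
      ((p.1 : ℂ) + 1) * (w - q p.2) ∈ D → w ∈ U},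
        {s : S | ((p.1 : ℂ) + 1) * ((φ s).1 z - q p.2) ∈ D} := by
    ext s
    simp only [mem_preimage, mem_iUnion, exists_prop]
    constructor
    · intro hs
      obtain ⟨δ, hδ, hδU⟩ := Metric.isOpen_iff.1 hU _ hs
      obtain ⟨N, hN⟩ := exists_nat_one_div_lt (half_pos hδ)
      have hN0 : (0 : ℝ) < N + 1 := by positivity
      have hnorm : ‖(N : ℂ) + 1‖ = N + 1 := by
        rw [← Nat.cast_add_one, Complex.norm_natCast, Nat.cast_add_one]
      obtain ⟨k, hk⟩ := (TopologicalSpace.denseRange_denseSeq ℂ).exists_dist_lt ((φ s).1 z)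
        (by positivity : (0 : ℝ) < 1 / (N + 1))
      rw [dist_eq_norm] at hk
      -- The rescaled copy of `D` contains the open disc of radius `1 / (N + 1)` about `q k` and
      -- lies in the closed one, whose points are within `δ` of the given value.
      refine ⟨(N, k), fun w hw => hδU ?_, exists_isTaylorSequence z ?_⟩
      · obtain ⟨F, hF⟩ := hw
        have h1 := hF.norm_le_one
        rw [norm_mul, hnorm, mul_comm, ← le_div_iff₀ hN0] at h1
        rw [mem_ball_iff_norm]
        calc ‖w - (φ s).1 z‖ = ‖(w - q k) - ((φ s).1 z - q k)‖ := by congr 1; ring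
          _ ≤ ‖w - q k‖ + ‖(φ s).1 z - q k‖ := norm_sub_le _ _
          _ < δ / 2 + δ / 2 := add_lt_add (h1.trans_lt hN) (hk.trans hN)
          _ = δ := by ring
      · rw [norm_mul, hnorm, mul_comm, ← lt_div_iff₀ hN0]
        exact hk
    · rintro ⟨p, hp, hs⟩
      exact hp _ hs
  rw [this]
  exact MeasurableSet.biUnion (to_countable _) fun p _ => hm _ _

end Measurability

/-! ### From Borel measurability to homeomorphism. -/

theorem isHomeomorph_of_ringEquiv {S : Type*} [NonUnitalRing S] [TopologicalSpace S]
    [IsPolishRing S] (hΩ : (Ω : Set ℂ).Nonempty) (φ : S ≃+* analyticFunctions Ω) :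
    IsHomeomorph φ := by
  borelize S ↥(analyticFunctions Ω)
  have : Nonempty Ω := hΩ.to_subtype
  let q := TopologicalSpace.denseSeq Ω
  let ev : analyticFunctions Ω → ℕ → ℂ := fun f n => f.1 (q n)
  have hev : Continuous ev := continuous_pi fun n =>
    (continuous_eval_const (q n)).comp continuous_subtype_val
  have hevi : Function.Injective ev := fun f g hfg => ext_iff_apply.2 fun x =>
    congrFun (DenseRange.equalizer (TopologicalSpace.denseRange_denseSeq Ω) f.1.continuous
      g.1.continuous hfg) x
  have hφ : Measurable φ := (hev.measurableEmbedding hevi).measurable_comp_iff.1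
    (measurable_pi_iff.2 fun n => measurable_apply φ (q n))
  have hφc : Continuous φ :=
    AddMonoidHom.continuous_of_borelMeasurable (G := S) (H := analyticFunctions Ω)
      (AddMonoidHomClass.toAddMonoidHom φ) hφ
  -- Lusin–Souslin: a continuous injection between Polish spaces maps Borel sets to Borel sets.
  have hsymm : Measurable φ.symm :=
    (hφc.measurableEmbedding φ.injective).measurable_comp_iff.1
      (by simpa [Function.comp_def] using measurable_id')
  have hsymmc : Continuous φ.symm :=
    AddMonoidHom.continuous_of_borelMeasurable (G := analyticFunctions Ω) (H := S)
      (AddMonoidHomClass.toAddMonoidHom φ.symm) hsymm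
  exact isHomeomorph_iff_exists_inverse.2
    ⟨hφc, φ.symm, φ.symm_apply_apply, φ.apply_symm_apply, hsymmc⟩

theorem isEmbedding_algebraMap (hΩ : (Ω : Set ℂ).Nonempty) :
    IsEmbedding (algebraMap ℂ (analyticFunctions Ω)) := by
  obtain ⟨z, hz⟩ := hΩ
  have hev : Continuous fun f : analyticFunctions Ω => f.1 ⟨z, hz⟩ :=
    (continuous_eval_const (⟨z, hz⟩ : Ω)).comp continuous_subtype_val
  have hc : Continuous (algebraMap ℂ (analyticFunctions Ω)) :=
    (ContinuousMap.continuous_const' (X := Ω) (Y := ℂ)).subtype_mk _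
  exact .of_leftInverse (fun c => rfl) hev hc

end analyticFunctions

theorem theorem4 (Ω : TopologicalSpace.Opens ℂ) (hΩ : (Ω : Set ℂ).Nonempty) :
    IsPolishRing (analyticFunctions Ω) ∧
    IsAlgebraicallyDetermined.{w} (analyticFunctions Ω) ∧
    ∀ (R : Type w) [NonUnitalRing R] [TopologicalSpace R] [IsPolishRing R]
      (φ : R ≃+* analyticFunctions Ω),
      Topology.IsEmbedding (fun c : ℂ => φ.symm (algebraMap ℂ (analyticFunctions Ω) c)) :=
  ⟨inferInstance, fun _ _ _ _ φ => analyticFunctions.isHomeomorph_of_ringEquiv hΩ φ,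
    fun _ _ _ _ φ => (analyticFunctions.isHomeomorph_of_ringEquiv hΩ φ).isEmbedding.of_comp_iff.1
      (by simpa [Function.comp_def] using analyticFunctions.isEmbedding_algebraMap hΩ)⟩
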